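/- Let $K$ be a field, let $a,b\ge 0$ be integers and put $\ell=a+b$. Let $x_0,\dots,x_\ell\in K$ be pairwise distinct, $X=\{x_0,\dots,x_\ell\}$, and let $y_0,\dots,y_\ell\in K$. A solution of the Cauchy interpolation problem for these data is a fraction $A/B$ with $A,B\in K[x]$, $\deg A\le a$, $\deg B\le b$, such that $B(x_i)\ne 0$ and $A(x_i)/B(x_i)=y_i$ for $0\le i\le \ell$. For finite subsets $U,V$ of a commutative ring put $R(U,V)=\prod_{u\in U,\,v\in V}(u-v)$, writing $R(x,V)$ and $R(U,x)$ when one of the sets is $\{x\}$, $x$ being the variable of $K[x]$. Suppose that for at least one integer $d$ with $0\le d\le a$ the polynomial $$A_0:=\sum_{X'\subset X,\ |X'|=d} R(x,X')\,\frac{\prod_{x_j\notin X'}y_j}{R(X\setminus X',X')}\in K[x]$$ is nonzero; let $d$ be the largest such integer, let $A_0$ be the corresponding polynomial, and set $$B_0:=\sum_{X''\subset X,\ |X''|=\ell-d} R(X'',x)\,\frac{\prod_{x_j\in X''}y_j}{R(X'',X\setminus X'')}\in K[x].$$ Then $\deg B_0\le b$, and the Cauchy interpolation problem has a solution if and only if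 $B_0(x_i)\neq 0$ for all $0\le i\le \ell$. In that case $A_0/B_0$ is a solution, and every solution $A/B$ satisfies $A/B=A_0/B_0$ in $K(x)$. -/

import Mathlib

open Polynomial

namespace CauchyInterp

/-- `R(U, V) = ∏_{u ∈ U, v ∈ V} (u - v)` for finite subsets `U`, `V` of a commutative ring. -/
def R {S : Type*} [CommRing S] (U V : Finset S) : S :=
  ∏ u ∈ U, ∏ v ∈ V, (u - v)

/-- A finite set of elements of `K`, regarded as a set of constant polynomials. -/
noncomputable def constPolys {K : Type*} [Field K] (U : Finset K) : Finset K[X] :=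
  U.map ⟨C, C_injective⟩

/-- The set of nodes `{x_0, …, x_n}`. -/
def nodes {K : Type*} [DecidableEq K] {n : ℕ} (x : Fin (n + 1) → K) : Finset K :=
  Finset.univ.image x

/-- `∑_{X' ⊆ X, |X'| = d} R(x, X') (∏_{x_j ∉ X'} y_j) / R(X \ X', X')` in `K[x]`,
for the data `x_0, …, x_ℓ`, `y_0, …, y_ℓ`. -/
noncomputable def A₀ {K : Type*} [Field K] [DecidableEq K] {ℓ : ℕ}
    (x y : Fin (ℓ + 1) → K) (d : ℕ) : K[X] :=
  ∑ X' ∈ (nodes x).powersetCard d,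
    R {X} (constPolys X') * C ((∏ j with x j ∉ X', y j) / R (nodes x \ X') X')

/-- `∑_{X'' ⊆ X, |X''| = ℓ - d} R(X'', x) (∏_{x_j ∈ X''} y_j) / R(X'', X \ X'')` in `K[x]`,
for the data `x_0, …, x_ℓ`, `y_0, …, y_ℓ` and `d ≤ ℓ`. -/
noncomputable def B₀ {K : Type*} [Field K] [DecidableEq K] {ℓ : ℕ}
    (x y : Fin (ℓ + 1) → K) (d : ℕ) : K[X] :=
  ∑ X'' ∈ (nodes x).powersetCard (ℓ - d),
    R (constPolys X'') {X} * C ((∏ j with x j ∈ X'', y j) / R X'' (nodes x \ X''))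

/-- `(A, B)` solves the Cauchy interpolation problem: `deg A ≤ a`, `deg B ≤ b`, and the fraction
`A / B` is defined at every node `x_i` and takes the value `y_i` there. -/
def IsSolution {K : Type*} [Field K] (a b : ℕ) (x y : Fin (a + b + 1) → K) (A B : K[X]) : Prop :=
  A.degree ≤ a ∧ B.degree ≤ b ∧ ∀ i, B.eval (x i) ≠ 0 ∧ A.eval (x i) / B.eval (x i) = y i

end CauchyInterp

/-! ### Sylvester's single sums as determinants of the linearized problem -/

namespace CauchyInterp

variable {K : Type*} [Field K]

/-! Linearize to `A(x_i) = y_i B(x_i)`. With `deg A < p`, `deg B < q` and `p + q` nodes this is a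
square system, and its determinant is a Vandermonde factor times `sylvesterSum`
(`det_pairMatrix_one`), so vanishing of the sum detects nontrivial solutions. Both the coefficient
of `A₀` in degree `d` and each value of `B₀` are such sums, and `A₀`, `B₀` solve the linearized
problem (`eval_A₀`). Hence `A₀ = 0` yields a nonzero solution of small degree, while one of still
smaller degree forces `A₀ = 0`. Solutions whose cross products have degree at most `ℓ` are
proportional (`cross_mul_eq`). So if `deg B₀ > b`, or if `B₀` vanishes at a node although the Cauchy
problem is solvable, a solution small enough to kill `A₀` appears, a contradiction. -/

/-- The matrix of the linear map `(A, B) ↦ (α i * A (x i) + β i * B (x i))_i` on pairs of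
polynomials with `deg A < p` and `deg B < q`. -/
def pairMatrix (p q : ℕ) (x α β : Fin (p + q) → K) : Matrix (Fin (p + q)) (Fin (p + q)) K :=
  .of fun i j ↦ j.addCases (fun u ↦ α i * x i ^ (u : ℕ)) (fun v ↦ β i * x i ^ (v : ℕ))

lemma eval_sum_fin_monomial {n : ℕ} (c : Fin n → K) (t : K) :
    (∑ i : Fin n, monomial (i : ℕ) (c i)).eval t = ∑ i : Fin n, c i * t ^ (i : ℕ) := by
  simp [eval_finsetSum, eval_monomial]

lemma eval_eq_sum_fin {n : ℕ} {A : K[X]} (hA : A.degree < n) (t : K) :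
    A.eval t = ∑ i : Fin n, A.coeff i * t ^ (i : ℕ) := by
  rcases eq_or_ne A 0 with rfl | h0
  · simp
  · rw [eval_eq_sum_range' ((natDegree_lt_iff_degree_lt h0).2 hA), Finset.sum_range]

/-- `pairMatrix` is singular if and only if the corresponding homogeneous problem has a nontrivial
solution. -/
lemma det_pairMatrix_eq_zero_iff (p q : ℕ) (x α β : Fin (p + q) → K) :
    (pairMatrix p q x α β).det = 0 ↔ ∃ A B : K[X], (A ≠ 0 ∨ B ≠ 0) ∧ A.degree < p ∧
      B.degree < q ∧ ∀ i, α i * A.eval (x i) + β i * B.eval (x i) = 0 := by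
  rw [← Matrix.exists_mulVec_eq_zero_iff]
  constructor
  · rintro ⟨v, hv, h⟩
    refine ⟨∑ i : Fin p, monomial (i : ℕ) (v (Fin.castAdd q i)),
      ∑ i : Fin q, monomial (i : ℕ) (v (Fin.natAdd p i)), ?_, ?_, ?_, fun i ↦ ?_⟩
    · by_contra! hAB
      refine hv (funext fun j ↦ ?_)
      induction j using Fin.addCases with
      | left u =>
        simpa [finsetSum_coeff, coeff_monomial, Fin.val_inj] using congr_arg (coeff · (u : ℕ)) hAB.1
      | right u =>
        simpa [finsetSum_coeff, coeff_monomial, Fin.val_inj] using congr_arg (coeff · (u : ℕ)) hAB.2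
    · exact (degree_sum_le _ _).trans_lt ((Finset.sup_lt_iff (WithBot.bot_lt_coe p)).2
        fun i _ ↦ (degree_monomial_le _ _).trans_lt (Nat.cast_lt.2 i.2))
    · exact (degree_sum_le _ _).trans_lt ((Finset.sup_lt_iff (WithBot.bot_lt_coe q)).2
        fun i _ ↦ (degree_monomial_le _ _).trans_lt (Nat.cast_lt.2 i.2))
    · have := congr_fun h i
      simp only [Matrix.mulVec, dotProduct, Fin.sum_univ_add, pairMatrix, Matrix.of_apply,
        Fin.addCases_left, Fin.addCases_right, Pi.zero_apply] at this
      rw [eval_sum_fin_monomial, eval_sum_fin_monomial, ← this, Finset.mul_sum, Finset.mul_sum]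
      congr 1 <;> exact Finset.sum_congr rfl fun _ _ ↦ by ring
  · rintro ⟨A, B, hAB, hA, hB, h⟩
    refine ⟨Fin.addCases (fun u ↦ A.coeff u) (fun v ↦ B.coeff v), fun h0 ↦ ?_, funext fun i ↦ ?_⟩
    · have hA0 : A = 0 := by
        ext n
        by_cases hn : n < p
        · simpa only [Fin.addCases_left, Pi.zero_apply, coeff_zero] using
            congr_fun h0 (Fin.castAdd q ⟨n, hn⟩)
        · exact coeff_eq_zero_of_degree_lt (hA.trans_le (by exact_mod_cast not_lt.1 hn))
      have hB0 : B = 0 := by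
        ext n
        by_cases hn : n < q
        · simpa only [Fin.addCases_right, Pi.zero_apply, coeff_zero] using
            congr_fun h0 (Fin.natAdd p ⟨n, hn⟩)
        · exact coeff_eq_zero_of_degree_lt (hB.trans_le (by exact_mod_cast not_lt.1 hn))
      simp [hA0, hB0] at hAB
    · rw [Pi.zero_apply, ← h i, eval_eq_sum_fin hA, eval_eq_sum_fin hB, Finset.mul_sum,
        Finset.mul_sum]
      simp only [Matrix.mulVec, dotProduct, Fin.sum_univ_add, pairMatrix, Matrix.of_apply,
        Fin.addCases_left, Fin.addCases_right]
      congr 1 <;> exact Finset.sum_congr rfl fun _ _ ↦ by ring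

lemma sum_pow_mul_shifted_coeff {f : K[X]} {m j N : ℕ} (hf : f.natDegree ≤ m) (hN : j + m < N)
    (t : K) : ∑ k : Fin N, t ^ (k : ℕ) *
      (if (k : ℕ) ∈ Set.Icc j (j + m) then f.coeff (k - j) else 0) = f.eval t * t ^ j := by
  have hd : (f * X ^ j).degree < (N : WithBot ℕ) := by
    refine degree_le_natDegree.trans_lt (Nat.cast_lt.2 ?_)
    have := natDegree_mul_le (p := f) (q := X ^ j)
    rw [natDegree_X_pow] at this
    omega
  have he : f.eval t * t ^ j = (f * X ^ j).eval t := by simp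
  rw [he, eval_eq_sum_fin hd]
  refine Finset.sum_congr rfl fun k _ ↦ ?_
  rw [mul_comm, coeff_mul_X_pow']
  simp only [Set.mem_Icc]
  congr 1
  split_ifs with h₁ h₂ h₂
  · rfl
  · omega
  · exact (coeff_eq_zero_of_natDegree_lt (by omega)).symm
  · rfl

/-- The columns of the Sylvester matrix are the coefficient vectors of `g * X ^ u` and `f * X ^ v`;
multiplying by the Vandermonde matrix evaluates them at the nodes. -/
lemma vandermonde_mul_sylvester (p q : ℕ) (x : Fin (p + q) → K) (f g : K[X])
    (hf : f.natDegree ≤ p) (hg : g.natDegree ≤ q) :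
    Matrix.vandermonde x * sylvester f g p q =
      pairMatrix p q x (fun i ↦ g.eval (x i)) (fun i ↦ f.eval (x i)) := by
  ext i j
  induction j using Fin.addCases with
  | left u =>
    simp only [Matrix.mul_apply, Matrix.vandermonde_apply, sylvester, pairMatrix, Matrix.of_apply,
      Fin.addCases_left]
    exact sum_pow_mul_shifted_coeff hg (by omega) _
  | right v =>
    simp only [Matrix.mul_apply, Matrix.vandermonde_apply, sylvester, pairMatrix, Matrix.of_apply,
      Fin.addCases_right]
    exact sum_pow_mul_shifted_coeff hf (by omega) _

lemma pairMatrix_mul (p q : ℕ) (x c α β : Fin (p + q) → K) :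
    pairMatrix p q x (fun i ↦ c i * α i) (fun i ↦ c i * β i) =
      Matrix.diagonal c * pairMatrix p q x α β := by
  ext i j
  rw [Matrix.diagonal_mul]
  induction j using Fin.addCases <;>
    simp only [pairMatrix, Matrix.of_apply, Fin.addCases_left, Fin.addCases_right, mul_assoc]

lemma resultant_nodal {ι : Type*} (s : Finset ι) (x : ι → K) (g : K[X]) {m n : ℕ}
    (hs : s.card = m) (hg : g.natDegree ≤ n) :
    (Lagrange.nodal s x).resultant g m n = ∏ i ∈ s, g.eval (x i) := by
  have h := resultant_prod_left s (fun i ↦ X - C (x i)) g n (by simp) hg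
  rw [← Lagrange.nodal, Lagrange.natDegree_nodal, hs] at h
  rw [h]
  exact Finset.prod_congr rfl fun i _ ↦ by rw [natDegree_X_sub_C, resultant_X_sub_C_left _ _ _ hg]

lemma prod_prod_compl_sub_ne_zero {n : ℕ} {x : Fin n → K} (hx : Function.Injective x)
    (s : Finset (Fin n)) : ∏ i ∈ s, ∏ j ∈ sᶜ, (x i - x j) ≠ 0 := by
  refine Finset.prod_ne_zero_iff.2 fun i hi ↦ Finset.prod_ne_zero_iff.2 fun j hj ↦ ?_
  exact sub_ne_zero.2 (hx.ne fun h ↦ Finset.mem_compl.1 hj (h ▸ hi))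

/-- Take `f` and `g` to be the nodal polynomials of `sᶜ` and `s`. Each node kills exactly one of
them, so the evaluated Sylvester matrix is a row scaling of the indicator matrix; its determinant is
known from the resultant of `f` and `g`. -/
lemma det_pairMatrix_indicator (p q : ℕ) (x : Fin (p + q) → K) (hx : Function.Injective x)
    (s : Finset (Fin (p + q))) (hs : s.card = q) :
    (pairMatrix p q x (fun i ↦ if i ∈ s then 0 else 1) (fun i ↦ if i ∈ s then 1 else 0)).det =
      (Matrix.vandermonde x).det / ∏ i ∈ s, ∏ j ∈ sᶜ, (x i - x j) := by
  have hc := s.card_add_card_compl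
  rw [Fintype.card_fin] at hc
  set f := Lagrange.nodal sᶜ x with hf
  set g := Lagrange.nodal s x with hg
  have hfd : f.natDegree ≤ p := by rw [hf, Lagrange.natDegree_nodal]; omega
  have hgd : g.natDegree ≤ q := by rw [hg, Lagrange.natDegree_nodal]; omega
  have h₁ := vandermonde_mul_sylvester p q x f g hfd hgd
  have h₂ : pairMatrix p q x (fun i ↦ g.eval (x i)) (fun i ↦ f.eval (x i)) =
      Matrix.diagonal (fun i ↦ if i ∈ s then f.eval (x i) else g.eval (x i)) *
        pairMatrix p q x (fun i ↦ if i ∈ s then 0 else 1) (fun i ↦ if i ∈ s then 1 else 0) := by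
    rw [← pairMatrix_mul]
    congr 1 <;> funext i <;> by_cases hi : i ∈ s <;> simp [hi, hf, hg, Lagrange.eval_nodal_at_node]
  have h₃ := congr_arg Matrix.det (h₁.trans h₂)
  rw [Matrix.det_mul, Matrix.det_mul, Matrix.det_diagonal, ← Polynomial.resultant, hf,
    resultant_nodal sᶜ x g (by omega) hgd, ← hf, Finset.prod_ite] at h₃
  have hg0 : ∏ i ∈ sᶜ, g.eval (x i) ≠ 0 := Finset.prod_ne_zero_iff.2 fun i hi ↦ by
    rw [hg, Lagrange.eval_nodal]
    exact Finset.prod_ne_zero_iff.2 fun j hj ↦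
      sub_ne_zero.2 (hx.ne fun h ↦ Finset.mem_compl.1 hi (h ▸ hj))
  have e₁ : Finset.univ.filter (· ∈ s) = s := by ext; simp
  have e₂ : Finset.univ.filter (· ∉ s) = sᶜ := by ext; simp
  have e₃ : ∏ i ∈ s, f.eval (x i) = ∏ i ∈ s, ∏ j ∈ sᶜ, (x i - x j) :=
    Finset.prod_congr rfl fun i _ ↦ by rw [hf, Lagrange.eval_nodal]
  rw [e₁, e₂, e₃] at h₃
  rw [eq_div_iff (prod_prod_compl_sub_ne_zero hx s)]
  refine mul_right_cancel₀ hg0 ?_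
  rw [h₃]
  ring

/-- One of the two blocks has fewer nodes than columns, so its nodal polynomial is a nontrivial
kernel element. -/
lemma det_pairMatrix_indicator_of_card_ne (p q : ℕ) (x : Fin (p + q) → K)
    (s : Finset (Fin (p + q))) (hs : s.card ≠ q) :
    (pairMatrix p q x (fun i ↦ if i ∈ s then 0 else 1) (fun i ↦ if i ∈ s then 1 else 0)).det =
      0 := by
  have hc := s.card_add_card_compl
  rw [Fintype.card_fin] at hc
  have hz : ∀ t : Finset (Fin (p + q)), ∀ i ∈ t, (Lagrange.nodal t x).eval (x i) = 0 :=
    fun t i hi ↦ Lagrange.eval_nodal_at_node hi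
  have hd : ∀ (t : Finset (Fin (p + q))) (m : ℕ), t.card < m → (Lagrange.nodal t x).degree < m :=
    fun t m h ↦ by rw [Lagrange.degree_nodal]; exact Nat.cast_lt.2 h
  rw [det_pairMatrix_eq_zero_iff]
  rcases hs.lt_or_gt with hs | hs
  · refine ⟨0, Lagrange.nodal s x, .inr Lagrange.nodal_ne_zero, by simp, hd _ _ hs, fun i ↦ ?_⟩
    by_cases hi : i ∈ s <;> simp [hi, hz]
  · refine ⟨Lagrange.nodal sᶜ x, 0, .inl Lagrange.nodal_ne_zero, hd _ _ (by omega), by simp,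
      fun i ↦ ?_⟩
    by_cases hi : i ∈ s <;> simp [hi, hz]

/-- `∑_{|s| = q} ∏_{i ∈ s} y i / ∏_{i ∈ s, j ∉ s} (x i - x j)`. -/
def sylvesterSum {n : ℕ} (x y : Fin n → K) (q : ℕ) : K :=
  ∑ s ∈ Finset.univ.powersetCard q, (∏ i ∈ s, y i) / ∏ i ∈ s, ∏ j ∈ sᶜ, (x i - x j)

lemma det_pairMatrix_one (p q : ℕ) (x y : Fin (p + q) → K) (hx : Function.Injective x) :
    (pairMatrix p q x 1 y).det = (Matrix.vandermonde x).det * sylvesterSum x y q := by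
  let u : Fin (p + q) → Fin (p + q) → K := fun i j ↦
    j.addCases (fun k ↦ x i ^ (k : ℕ)) (fun _ ↦ 0)
  let v : Fin (p + q) → Fin (p + q) → K := fun i j ↦
    j.addCases (fun _ ↦ 0) (fun k ↦ y i * x i ^ (k : ℕ))
  have huv : pairMatrix p q x 1 y = Matrix.of (v + u) := by
    ext i j
    induction j using Fin.addCases <;> simp [u, v, pairMatrix]
  have hpw : ∀ s : Finset (Fin (p + q)), Matrix.of (s.piecewise v u) =
      Matrix.diagonal (fun i ↦ if i ∈ s then y i else 1) *
        pairMatrix p q x (fun i ↦ if i ∈ s then 0 else 1) (fun i ↦ if i ∈ s then 1 else 0) := by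
    intro s
    rw [← pairMatrix_mul]
    ext i j
    by_cases hi : i ∈ s <;> induction j using Fin.addCases <;> simp [hi, u, v, pairMatrix]
  -- Multilinearity in the rows: `s` records the rows that take the `y`-part. Only sets of
  -- cardinality `q` contribute.
  have hexp : (Matrix.of (v + u)).det = ∑ s : Finset (Fin (p + q)),
      (Matrix.of (s.piecewise v u)).det :=
    Matrix.detRowAlternating.map_add_univ v u
  rw [huv, hexp, sylvesterSum, Finset.mul_sum, ← Finset.powerset_univ]
  rw [← Finset.sum_subset (s₁ := Finset.univ.powersetCard q)
    fun s _ ↦ Finset.mem_powerset.2 s.subset_univ]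
  · refine Finset.sum_congr rfl fun s hs ↦ ?_
    rw [hpw, Matrix.det_mul, Matrix.det_diagonal,
      det_pairMatrix_indicator p q x hx s (Finset.mem_powersetCard.1 hs).2]
    simp only [Finset.prod_ite_mem, Finset.univ_inter]
    ring
  · intro s _ hs
    rw [hpw, Matrix.det_mul, det_pairMatrix_indicator_of_card_ne p q x s, mul_zero]
    exact fun h ↦ hs (Finset.mem_powersetCard.2 ⟨Finset.subset_univ _, h⟩)

lemma sylvesterSum_eq_zero_iff {n p q : ℕ} (hn : p + q = n) (x y : Fin n → K)
    (hx : Function.Injective x) :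
    sylvesterSum x y q = 0 ↔ ∃ A B : K[X], (A ≠ 0 ∨ B ≠ 0) ∧ A.degree < p ∧
      B.degree < q ∧ ∀ i, A.eval (x i) = y i * B.eval (x i) := by
  subst hn
  have hV := Matrix.det_vandermonde_ne_zero_iff.2 hx
  rw [← or_iff_right (a := (Matrix.vandermonde x).det = 0)
    (b := sylvesterSum x y q = 0) hV, ← mul_eq_zero, ← det_pairMatrix_one p q x y hx,
    det_pairMatrix_eq_zero_iff]
  constructor <;> rintro ⟨A, B, h0, hA, hB, h⟩ <;>
    refine ⟨A, -B, by simpa using h0, hA, by simpa using hB, fun i ↦ ?_⟩ <;>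
    have := h i <;> simp at this ⊢ <;> linear_combination this

end CauchyInterp

/-! ### Degrees, coefficients and values of `A₀` and `B₀` -/

namespace CauchyInterp

section Nodes

variable {K : Type*} [DecidableEq K] {ℓ : ℕ} {x : Fin (ℓ + 1) → K}

lemma sum_powersetCard_nodes {M : Type*} [AddCommMonoid M] (hx : Function.Injective x) (d : ℕ)
    (f : Finset K → M) :
    ∑ U ∈ (nodes x).powersetCard d, f U =
      ∑ s ∈ (Finset.univ : Finset (Fin (ℓ + 1))).powersetCard d, f (s.map ⟨x, hx⟩) := by
  have : nodes x = Finset.univ.map ⟨x, hx⟩ := by rw [Finset.map_eq_image]; rfl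
  rw [this, Finset.powersetCard_map, Finset.sum_map]
  rfl

lemma nodes_sdiff_map (hx : Function.Injective x) (s : Finset (Fin (ℓ + 1))) :
    nodes x \ s.map ⟨x, hx⟩ = sᶜ.map ⟨x, hx⟩ := by
  have : nodes x = Finset.univ.map ⟨x, hx⟩ := by rw [Finset.map_eq_image]; rfl
  rw [this, ← Finset.map_sdiff, Finset.compl_eq_univ_sdiff]

lemma filter_mem_map (hx : Function.Injective x) (s : Finset (Fin (ℓ + 1))) :
    Finset.univ.filter (fun j ↦ x j ∈ s.map ⟨x, hx⟩) = s := by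
  ext j
  simp

lemma filter_notMem_map (hx : Function.Injective x) (s : Finset (Fin (ℓ + 1))) :
    Finset.univ.filter (fun j ↦ x j ∉ s.map ⟨x, hx⟩) = sᶜ := by
  ext j
  simp

end Nodes

variable {K : Type*} [Field K]

section Formulas

variable [DecidableEq K] {ℓ : ℕ} {x : Fin (ℓ + 1) → K}

lemma A₀_eq_sum (hx : Function.Injective x) (y : Fin (ℓ + 1) → K) (d : ℕ) :
    A₀ x y d = ∑ s ∈ Finset.univ.powersetCard d, Lagrange.nodal s x *
      C ((∏ j ∈ sᶜ, y j) / ∏ i ∈ sᶜ, ∏ j ∈ s, (x i - x j)) := by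
  rw [A₀, sum_powersetCard_nodes hx]
  refine Finset.sum_congr rfl fun s _ ↦ ?_
  rw [nodes_sdiff_map, filter_notMem_map]
  simp [R, constPolys, Lagrange.nodal]

lemma B₀_eq_sum (hx : Function.Injective x) (y : Fin (ℓ + 1) → K) (d : ℕ) :
    B₀ x y d = ∑ s ∈ Finset.univ.powersetCard (ℓ - d), (∏ i ∈ s, (C (x i) - X)) *
      C ((∏ j ∈ s, y j) / ∏ i ∈ s, ∏ j ∈ sᶜ, (x i - x j)) := by
  rw [B₀, sum_powersetCard_nodes hx]
  refine Finset.sum_congr rfl fun s _ ↦ ?_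
  rw [nodes_sdiff_map, filter_mem_map]
  simp [R, constPolys]

lemma degree_A₀_le (hx : Function.Injective x) (y : Fin (ℓ + 1) → K) (d : ℕ) :
    (A₀ x y d).degree ≤ d := by
  rw [A₀_eq_sum hx]
  refine (degree_sum_le _ _).trans (Finset.sup_le fun s hs ↦ ?_)
  rw [← add_zero (d : WithBot ℕ)]
  refine degree_mul_le_of_le ?_ degree_C_le
  rw [Lagrange.degree_nodal, (Finset.mem_powersetCard.1 hs).2]

lemma degree_B₀_le (hx : Function.Injective x) (y : Fin (ℓ + 1) → K) (d : ℕ) :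
    (B₀ x y d).degree ≤ (ℓ - d : ℕ) := by
  rw [B₀_eq_sum hx]
  refine (degree_sum_le _ _).trans (Finset.sup_le fun s hs ↦ ?_)
  rw [← add_zero ((ℓ - d : ℕ) : WithBot ℕ)]
  refine degree_mul_le_of_le ?_ degree_C_le
  refine (degree_prod_le _ _).trans ?_
  refine (Finset.sum_le_card_nsmul _ _ 1 fun i _ ↦ ?_).trans ?_
  · rw [← neg_sub, degree_neg]
    exact (degree_X_sub_C _).le
  · rw [(Finset.mem_powersetCard.1 hs).2]
    simp

lemma eval_B₀ (hx : Function.Injective x) (y : Fin (ℓ + 1) → K) (d : ℕ) (t : K) :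
    (B₀ x y d).eval t = sylvesterSum x (fun j ↦ (x j - t) * y j) (ℓ - d) := by
  rw [B₀_eq_sum hx, eval_finsetSum, sylvesterSum]
  refine Finset.sum_congr rfl fun s _ ↦ ?_
  rw [eval_mul, eval_C, eval_prod, Finset.prod_mul_distrib, mul_div_assoc]
  simp

lemma coeff_A₀ (hx : Function.Injective x) (y : Fin (ℓ + 1) → K) {d : ℕ} (hd : d ≤ ℓ + 1) :
    (A₀ x y d).coeff d = sylvesterSum x y (ℓ + 1 - d) := by
  rw [A₀_eq_sum hx, finsetSum_coeff, sylvesterSum]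
  refine Finset.sum_nbij' (fun s ↦ sᶜ) (fun s ↦ sᶜ) ?_ ?_ (by simp) (by simp) ?_
  · intro s hs
    simp only [Finset.mem_powersetCard_univ, Finset.card_compl, Fintype.card_fin] at hs ⊢
    omega
  · intro s hs
    simp only [Finset.mem_powersetCard_univ, Finset.card_compl, Fintype.card_fin] at hs ⊢
    omega
  · intro s hs
    have h : (Lagrange.nodal s x).coeff d = 1 := by
      have := (Lagrange.nodal_monic (s := s) (v := x)).coeff_natDegree
      rwa [Lagrange.natDegree_nodal, (Finset.mem_powersetCard.1 hs).2] at this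
    rw [coeff_mul_C, h, one_mul, compl_compl]

/-- At `x i` only subsets avoiding `i` contribute on either side, and `s ↦ (insert i s)ᶜ` matches
them term by term. -/
lemma eval_A₀ (hx : Function.Injective x) (y : Fin (ℓ + 1) → K) {d : ℕ} (hd : d ≤ ℓ)
    (i : Fin (ℓ + 1)) : (A₀ x y d).eval (x i) = y i * (B₀ x y d).eval (x i) := by
  rw [A₀_eq_sum hx, B₀_eq_sum hx, eval_finsetSum, eval_finsetSum, Finset.mul_sum]
  rw [← Finset.sum_filter_of_ne (p := fun s ↦ i ∉ s), ← Finset.sum_filter_of_ne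
    (p := fun s ↦ i ∉ s) (s := Finset.univ.powersetCard (ℓ - d))]
  · refine Finset.sum_nbij' (fun s ↦ (insert i s)ᶜ) (fun s ↦ (insert i s)ᶜ) ?_ ?_ ?_ ?_ ?_
    · intro s hs
      simp only [Finset.mem_filter, Finset.mem_powersetCard_univ] at hs ⊢
      rw [Finset.card_compl, Finset.card_insert_of_notMem hs.2, Fintype.card_fin]
      exact ⟨by omega, by simp⟩
    · intro s hs
      simp only [Finset.mem_filter, Finset.mem_powersetCard_univ] at hs ⊢
      rw [Finset.card_compl, Finset.card_insert_of_notMem hs.2, Fintype.card_fin]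
      exact ⟨by omega, by simp⟩
    · intro s hs
      have := (Finset.mem_filter.1 hs).2
      ext j
      by_cases hj : j = i <;> simp [hj, this]
    · intro s hs
      have := (Finset.mem_filter.1 hs).2
      ext j
      by_cases hj : j = i <;> simp [hj, this]
    · intro s hs
      have hi := (Finset.mem_filter.1 hs).2
      obtain ⟨s', hs'⟩ : ∃ s', s' = (insert i s)ᶜ := ⟨_, rfl⟩
      have hi' : i ∉ s' := by simp [hs']
      have hc : sᶜ = insert i s' := by
        ext j
        by_cases hj : j = i <;> simp [hj, hi, hs']
      have hc' : s'ᶜ = insert i s := by simp [hs']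
      rw [← hs', hc, hc', eval_mul, eval_mul, eval_C, eval_C, Lagrange.eval_nodal, eval_prod,
        Finset.prod_insert hi', Finset.prod_insert hi']
      simp only [Finset.prod_insert hi, Finset.prod_mul_distrib, eval_sub, eval_C, eval_X]
      have h₁ : ∏ j ∈ s, (x i - x j) ≠ 0 := Finset.prod_ne_zero_iff.2 fun j hj ↦
        sub_ne_zero.2 (hx.ne fun h ↦ hi (h ▸ hj))
      have h₂ : ∏ j ∈ s', (x j - x i) ≠ 0 := Finset.prod_ne_zero_iff.2 fun j hj ↦
        sub_ne_zero.2 (hx.ne fun h ↦ hi' (h ▸ hj))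
      rw [mul_div_mul_comm, ← mul_assoc]
      field_simp
  · intro s _ h hi
    refine h ?_
    rw [eval_mul, eval_prod, Finset.prod_eq_zero hi (by simp), zero_mul, mul_zero]
  · intro s _ h hi
    exact h (by rw [eval_mul, Lagrange.eval_nodal_at_node hi, zero_mul])

end Formulas

lemma eq_zero_of_eval_nodes {ℓ : ℕ} {x : Fin (ℓ + 1) → K} (hx : Function.Injective x) {P : K[X]}
    (hP : P.degree ≤ ℓ) (h : ∀ i, P.eval (x i) = 0) : P = 0 := by
  refine eq_zero_of_degree_lt_of_eval_index_eq_zero Finset.univ hx.injOn ?_ fun i _ ↦ h i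
  rw [Finset.card_univ, Fintype.card_fin]
  exact hP.trans_lt (Nat.cast_lt.2 ℓ.lt_succ_self)

/-- Two solutions of the linearized problem define the same fraction. -/
lemma cross_mul_eq {ℓ : ℕ} {x y : Fin (ℓ + 1) → K} (hx : Function.Injective x)
    {A B A' B' : K[X]} (h : ∀ i, A.eval (x i) = y i * B.eval (x i))
    (h' : ∀ i, A'.eval (x i) = y i * B'.eval (x i))
    (hd : A.natDegree + B'.natDegree ≤ ℓ) (hd' : A'.natDegree + B.natDegree ≤ ℓ) :
    A * B' = A' * B := by
  refine sub_eq_zero.1 (eq_zero_of_eval_nodes hx ((degree_sub_le _ _).trans (max_le ?_ ?_))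
    fun i ↦ ?_)
  · exact natDegree_le_iff_degree_le.1 (natDegree_mul_le.trans hd)
  · exact natDegree_le_iff_degree_le.1 (natDegree_mul_le.trans hd')
  rw [eval_sub, eval_mul, eval_mul, h, h']
  ring

/-- If the linearized problem has a nonzero solution of degrees less than `d` and `ℓ - d`, then
`A₀` vanishes. -/
lemma A₀_eq_zero_of_degree_lt [DecidableEq K] {ℓ d : ℕ} {x y : Fin (ℓ + 1) → K}
    (hx : Function.Injective x) (hd : d ≤ ℓ) {A B : K[X]} (hAB : A ≠ 0 ∨ B ≠ 0)
    (hA : A.degree < d) (hB : B.degree < (ℓ - d : ℕ))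
    (h : ∀ i, A.eval (x i) = y i * B.eval (x i)) : A₀ x y d = 0 := by
  refine eq_zero_of_eval_nodes hx ((degree_A₀_le hx y d).trans (Nat.cast_le.2 hd)) fun i ↦ ?_
  rw [eval_A₀ hx y hd, eval_B₀ hx,
    (sylvesterSum_eq_zero_iff (p := d + 1) (by omega) _ _ hx).2, mul_zero]
  -- The value of `B₀` at `x i` is the sum for the data `(x j - x i) * y j`, which the factor `X - C
  -- (x i)` absorbs.
  refine ⟨(X - C (x i)) * A, B, ?_, ?_, hB, fun j ↦ ?_⟩
  · exact hAB.imp_left (mul_ne_zero (X_sub_C_ne_zero _))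
  · rw [degree_mul, degree_X_sub_C, add_comm]
    push_cast
    exact WithBot.add_lt_add_right (by simp) hA
  · rw [eval_mul, h j]
    simp
    ring

/-- If the `d`-th polynomial `A₀` vanishes, then the linearized problem has a nonzero solution of
degrees less than `d` and at most `ℓ - d`. -/
lemma exists_degree_lt_of_A₀_eq_zero [DecidableEq K] {ℓ d : ℕ} {x y : Fin (ℓ + 1) → K}
    (hx : Function.Injective x) (hd : d ≤ ℓ) (h : A₀ x y d = 0) :
    ∃ A B : K[X], (A ≠ 0 ∨ B ≠ 0) ∧ A.degree < d ∧ B.degree < (ℓ + 1 - d : ℕ) ∧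
      ∀ i, A.eval (x i) = y i * B.eval (x i) :=
  (sylvesterSum_eq_zero_iff (by omega) x y hx).1 (by rw [← coeff_A₀ hx y (by omega), h, coeff_zero])

end CauchyInterp

/-! ### Maximality of `d` and the Cauchy problem -/

namespace CauchyInterp

variable {K : Type*} [Field K]

lemma IsSolution.eval_eq {a b : ℕ} {x y : Fin (a + b + 1) → K} {A B : K[X]}
    (h : IsSolution a b x y A B) (i : Fin (a + b + 1)) :
    A.eval (x i) = y i * B.eval (x i) :=
  (div_eq_iff (h.2.2 i).1).1 (h.2.2 i).2

lemma IsSolution.ne_zero {a b : ℕ} {x y : Fin (a + b + 1) → K} {A B : K[X]}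
    (h : IsSolution a b x y A B) : B ≠ 0 := by
  rintro rfl
  exact (h.2.2 0).1 eval_zero

variable [DecidableEq K]

lemma B₀_ne_zero {ℓ d : ℕ} {x y : Fin (ℓ + 1) → K} (hx : Function.Injective x) (hd : d ≤ ℓ)
    (h : A₀ x y d ≠ 0) : B₀ x y d ≠ 0 := fun h0 ↦ h <|
  eq_zero_of_eval_nodes hx ((degree_A₀_le hx y d).trans (Nat.cast_le.2 hd)) fun i ↦ by
    rw [eval_A₀ hx y hd, h0, eval_zero, mul_zero]

lemma degree_B₀_le_of_isGreatest {a b d : ℕ} {x y : Fin (a + b + 1) → K}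
    (hx : Function.Injective x) (hd : IsGreatest {e : ℕ | e ≤ a ∧ A₀ x y e ≠ 0} d) :
    (B₀ x y d).degree ≤ b := by
  obtain ⟨⟨hda, hA0⟩, hmax⟩ := hd
  have hB0 := B₀_ne_zero hx (by omega) hA0
  have hdA := natDegree_le_of_degree_le (degree_A₀_le hx y d)
  have hdB := natDegree_le_of_degree_le (degree_B₀_le hx y d)
  rw [← natDegree_le_iff_degree_le]
  by_contra! hb
  -- This `e` satisfies `d < e ≤ a`, so maximality gives `A₀ x y e = 0`; the resulting `B` has
  -- degree below that of `B₀`.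
  obtain ⟨e, he⟩ : ∃ e, e + (B₀ x y d).natDegree = a + b + 1 :=
    ⟨a + b + 1 - (B₀ x y d).natDegree, by omega⟩
  have hAe : A₀ x y e = 0 := by
    by_contra hne
    have := hmax ⟨by omega, hne⟩
    omega
  obtain ⟨A, B, hAB, hA, hB, h⟩ := exists_degree_lt_of_A₀_eq_zero hx (by omega) hAe
  have hA' : A.natDegree < e := by
    rcases eq_or_ne A 0 with rfl | h0
    · rw [natDegree_zero]; omega
    · exact (natDegree_lt_iff_degree_lt h0).2 hA
  have hB' : B.natDegree < a + b + 1 - e := by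
    rcases eq_or_ne B 0 with rfl | h0
    · rw [natDegree_zero]; omega
    · exact (natDegree_lt_iff_degree_lt h0).2 hB
  have hc : A * B₀ x y d = A₀ x y d * B :=
    cross_mul_eq hx h (eval_A₀ hx y (by omega)) (by omega) (by omega)
  have hA1 : A ≠ 0 := by
    rintro rfl
    rw [zero_mul, eq_comm, mul_eq_zero] at hc
    simp [hA0] at hc hAB
    exact hAB hc
  have hB1 : B ≠ 0 := by
    rintro rfl
    rw [mul_zero, mul_eq_zero] at hc
    exact hc.elim hA1 hB0
  -- Since `deg B < deg B₀ ≤ ℓ - d`, comparing degrees gives `deg A < deg A₀ ≤ d`.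
  have hn := congr_arg natDegree hc
  rw [natDegree_mul hA1 hB0, natDegree_mul hA0 hB1] at hn
  exact hA0 (A₀_eq_zero_of_degree_lt hx (by omega) (.inl hA1)
    ((natDegree_lt_iff_degree_lt hA1).1 (by omega))
    ((natDegree_lt_iff_degree_lt hB1).1 (by omega)) h)

lemma IsSolution.mul_B₀_eq {a b d : ℕ} {x y : Fin (a + b + 1) → K}
    (hx : Function.Injective x) (hd : IsGreatest {e : ℕ | e ≤ a ∧ A₀ x y e ≠ 0} d) {A B : K[X]}
    (h : IsSolution a b x y A B) : A * B₀ x y d = A₀ x y d * B := by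
  have hda := hd.1.1
  have hB₀ := natDegree_le_of_degree_le (degree_B₀_le_of_isGreatest hx hd)
  have hA₀ := natDegree_le_of_degree_le (degree_A₀_le hx y d)
  have hA := natDegree_le_of_degree_le h.1
  have hB := natDegree_le_of_degree_le h.2.1
  exact cross_mul_eq hx h.eval_eq (eval_A₀ hx y (by omega)) (by omega) (by omega)

lemma IsSolution.eval_B₀_ne_zero {a b d : ℕ} {x y : Fin (a + b + 1) → K}
    (hx : Function.Injective x) (hd : IsGreatest {e : ℕ | e ≤ a ∧ A₀ x y e ≠ 0} d) {A B : K[X]}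
    (h : IsSolution a b x y A B) (i : Fin (a + b + 1)) : (B₀ x y d).eval (x i) ≠ 0 := by
  intro h0
  obtain ⟨hda, hA0⟩ := hd.1
  have hB0 := B₀_ne_zero hx (by omega) hA0
  have hw := eval_A₀ hx y (d := d) (by omega)
  have hc := h.mul_B₀_eq hx hd
  have hdA := natDegree_le_of_degree_le (degree_A₀_le hx y d)
  have hdB := natDegree_le_of_degree_le (degree_B₀_le hx y d)
  -- A common root `x i` can be divided out. The quotients still solve the linearized problem, even
  -- at `x i`, because they are proportional to `A`, `B` and `B` vanishes at no node.
  obtain ⟨Q, hQ⟩ := dvd_iff_isRoot.2 h0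
  obtain ⟨P, hP⟩ := dvd_iff_isRoot.2 (show (A₀ x y d).IsRoot (x i) by
    rw [IsRoot, hw, h0, mul_zero])
  have hP0 : P ≠ 0 := by rintro rfl; exact hA0 (by rw [hP, mul_zero])
  have hQ0 : Q ≠ 0 := by rintro rfl; exact hB0 (by rw [hQ, mul_zero])
  have hX : X - C (x i) ≠ 0 := X_sub_C_ne_zero _
  have hPQ : A * Q = P * B := mul_left_cancel₀ hX (by
    rw [hP, hQ] at hc
    linear_combination hc)
  rw [hP, natDegree_mul hX hP0, natDegree_X_sub_C] at hdA
  rw [hQ, natDegree_mul hX hQ0, natDegree_X_sub_C] at hdB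
  refine hA0 (A₀_eq_zero_of_degree_lt hx (by omega) (.inl hP0)
    ((natDegree_lt_iff_degree_lt hP0).1 (by omega))
    ((natDegree_lt_iff_degree_lt hQ0).1 (by omega)) fun j ↦ ?_)
  have hj := congr_arg (eval (x j)) hPQ
  rw [eval_mul, eval_mul, h.eval_eq] at hj
  exact mul_right_cancel₀ (h.2.2 j).1 (by linear_combination -hj)

lemma isSolution_A₀_B₀ {a b d : ℕ} {x y : Fin (a + b + 1) → K}
    (hx : Function.Injective x) (hd : IsGreatest {e : ℕ | e ≤ a ∧ A₀ x y e ≠ 0} d)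
    (h : ∀ i, (B₀ x y d).eval (x i) ≠ 0) : IsSolution a b x y (A₀ x y d) (B₀ x y d) := by
  have hda := hd.1.1
  exact ⟨(degree_A₀_le hx y d).trans (Nat.cast_le.2 hda), degree_B₀_le_of_isGreatest hx hd,
    fun i ↦ ⟨h i, (div_eq_iff (h i)).2 (eval_A₀ hx y (by omega) i)⟩⟩

end CauchyInterp

theorem theorem3p1 {K : Type*} [Field K] [DecidableEq K] (a b : ℕ)
    (x y : Fin (a + b + 1) → K) (hx : Function.Injective x) (d : ℕ)
    (hd : IsGreatest {e : ℕ | e ≤ a ∧ CauchyInterp.A₀ x y e ≠ 0} d) :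
    (CauchyInterp.B₀ x y d).degree ≤ b ∧
    ((∃ A B : K[X], CauchyInterp.IsSolution a b x y A B) ↔
      ∀ i, (CauchyInterp.B₀ x y d).eval (x i) ≠ 0) ∧
    ((∃ A B : K[X], CauchyInterp.IsSolution a b x y A B) →
      CauchyInterp.IsSolution a b x y (CauchyInterp.A₀ x y d) (CauchyInterp.B₀ x y d) ∧
      ∀ A B : K[X], CauchyInterp.IsSolution a b x y A B →
        (algebraMap K[X] (RatFunc K) A / algebraMap K[X] (RatFunc K) B : RatFunc K) =
          algebraMap K[X] (RatFunc K) (CauchyInterp.A₀ x y d) /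
            algebraMap K[X] (RatFunc K) (CauchyInterp.B₀ x y d)) := by
  have hne : (∃ A B : K[X], CauchyInterp.IsSolution a b x y A B) →
      ∀ i, (CauchyInterp.B₀ x y d).eval (x i) ≠ 0 :=
    fun ⟨_, _, h⟩ ↦ h.eval_B₀_ne_zero hx hd
  refine ⟨CauchyInterp.degree_B₀_le_of_isGreatest hx hd,
    ⟨hne, fun h ↦ ⟨_, _, CauchyInterp.isSolution_A₀_B₀ hx hd h⟩⟩, fun hex ↦ ?_⟩
  have h₀ := CauchyInterp.isSolution_A₀_B₀ hx hd (hne hex)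
  refine ⟨h₀, fun A B h ↦ ?_⟩
  have hinj := IsFractionRing.injective K[X] (RatFunc K)
  rw [div_eq_div_iff ((map_ne_zero_iff _ hinj).2 h.ne_zero)
    ((map_ne_zero_iff _ hinj).2 h₀.ne_zero), ← map_mul, ← map_mul, h.mul_B₀_eq hx hd]
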